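/- Let $\mathbb F_q$ be a finite field with $\operatorname{char}(\mathbb F_q)=2$ or $q\equiv 1\pmod 4$, let $m=p$ be a prime, and suppose that $q$ is a primitive element modulo $p$ (its class generates $\mathbb F_p^\ast$). Let $R=\mathbb F_q[Y]/(Y^p-1)$, let $\overline{\phantom{x}}$ be the $\mathbb F_q$-algebra endomorphism of $R$ with $\overline{Y}=Y^{-1}=Y^{p-1}$, and put $\langle \mathbf x,\mathbf y\rangle=\sum_j x_j\overline{y_j}$ on $R^n$. A linear code of length $n$ over $R$ is an $R$-submodule $C$ of $R^n$; it is (Hermitian) self-dual if $C=C^\perp$ with respect to $\langle\cdot,\cdot\rangle$. Two codes over $R$ are permutation equivalent if a permutation of the coordinates carries one to the other. Building-up construction: let $C_0$ be a self-dual code over $R$ of length $2\ell$, let $\mathbf r_1,\dots,\mathbf r_k$ be the rows of a generator matrix of $C_0$ (a matrix whose rows generate $C_0$), let $c\in R$ with $c\overline c=-1$, let $\mathbf x\in R^{2\ell}$ with $\langle\mathbf x,\mathbf x\rangle=-1$, and put $y_i=-\langle \mathbf r_i,\mathbf x\rangle$. The code of length $2\ell+2$ built up from these data is the one generated by the rows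 $$(1,\,0,\,\mathbf x),\qquad (y_i,\;c\,y_i,\;\mathbf r_i)\quad(1\le i\le k).$$ (1) For every $\ell\ge 1$, every self-dual code over $R$ of length $2\ell+2$ is permutation equivalent to a code obtained by the building-up construction from some self-dual code over $R$ of length $2\ell$. (2) For $n\ge1$ let $\phi:\mathbb F_q^{pn}\to R^n$ be the bijection that sends $(c_{00},\dots,c_{0,n-1},c_{10},\dots,c_{p-1,n-1})$ to the vector with $j$-th component $\sum_{i=0}^{p-1}c_{ij}Y^i$, $0\le j\le n-1$. A linear code of length $pn$ over $\mathbb F_q$ is $n$-quasi-cyclic if it is invariant under $T^n$, where $T$ is the cyclic shift by one position. Then for every $n>2$, every $n$-quasi-cyclic code $D$ of length $pn$ over $\mathbb F_q$ that is self-dual with respect to the Euclidean inner product satisfies $n=2\ell+2$ for some integer $\ell\ge1$ and $D=\phi^{-1}(E)$, where $E$ is a code over $R$ of length $n$ that is permutation equivalent to a code obtained by the building-up construction from a self-dual code over $R$ of length $2\ell$. -/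

import Mathlib

open Polynomial

namespace QuasiCyclic

/-- The natural number `q` is a primitive element modulo `p`: its residue class is a
generator of the multiplicative group of `ZMod p`. -/
def IsPrimitiveElementMod (q p : ℕ) : Prop :=
  ∃ u : (ZMod p)ˣ, (u : ZMod p) = (q : ZMod p) ∧ ∀ v : (ZMod p)ˣ, v ∈ Subgroup.zpowers u

section Codes

/-- Two linear codes over `R` are (permutation) equivalent if a bijection of the coordinate
positions carries one to the other. -/
def PermEquivalent {R : Type*} [CommRing R] {a b : ℕ}
    (C : Submodule R (Fin a → R)) (C' : Submodule R (Fin b → R)) : Prop :=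
  ∃ e : Fin b ≃ Fin a, C' = C.map (LinearEquiv.funCongrLeft R R e).toLinearMap

/-- `G` is a generator matrix of `C`: its rows generate `C`. -/
def IsGeneratorMatrix {R : Type*} [CommRing R] {k n : ℕ}
    (G : Matrix (Fin k) (Fin n) R) (C : Submodule R (Fin n → R)) : Prop :=
  Submodule.span R (Set.range fun i => G i) = C

/-- The dual of a linear code over a field with respect to the standard Euclidean inner
product. -/
def euclideanDual {F : Type*} [Field F] {n : ℕ} (D : Submodule F (Fin n → F)) :
    Submodule F (Fin n → F) where
  carrier := {x | ∀ y ∈ D, ∑ j, x j * y j = 0}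
  zero_mem' := by intro y _; simp
  add_mem' := by
    intro a b ha hb y hy
    simp [add_mul, Finset.sum_add_distrib, ha y hy, hb y hy]
  smul_mem' := by
    intro t a ha y hy
    simp [mul_assoc, ← Finset.mul_sum, ha y hy]

/-- Euclidean self-dual codes. -/
def IsEuclideanSelfDual {F : Type*} [Field F] {n : ℕ} (D : Submodule F (Fin n → F)) : Prop :=
  D = euclideanDual D

/-- The standard shift `T (c₀, c₁, …, c_{n-1}) = (c_{n-1}, c₀, …, c_{n-2})`. -/
def shift {F : Type*} {n : ℕ} (c : Fin n → F) : Fin n → F :=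
  fun k => c ((finRotate n).symm k)

/-- A linear code is `ℓ`-quasi-cyclic if it is invariant under `T ^ ℓ`. -/
def IsQuasiCyclic {F : Type*} [Field F] {n : ℕ} (ℓ : ℕ) (D : Submodule F (Fin n → F)) : Prop :=
  ∀ c ∈ D, shift^[ℓ] c ∈ D

end Codes

section Ring

/-- The ring `R = F[Y] / (Y ^ m - 1)`. -/
abbrev QCRing (F : Type*) [Field F] (m : ℕ) : Type _ :=
  AdjoinRoot (X ^ m - 1 : F[X])

/-- The class of `Y` in `R = F[Y] / (Y ^ m - 1)`. -/
noncomputable def Y (F : Type*) [Field F] (m : ℕ) : QCRing F m :=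
  AdjoinRoot.root (X ^ m - 1 : F[X])

theorem Y_pow (F : Type*) [Field F] (m : ℕ) : Y F m ^ m = 1 := by
  have h := AdjoinRoot.eval₂_root (X ^ m - 1 : F[X])
  simpa [Y, sub_eq_zero] using h

/-- The conjugation of `R`: the `F`-algebra endomorphism with `Y ↦ Y ^ (m - 1) = Y⁻¹`. -/
noncomputable def conj (F : Type*) [Field F] (m : ℕ) : QCRing F m →ₐ[F] QCRing F m :=
  AdjoinRoot.liftAlgHom (X ^ m - 1 : F[X]) (Algebra.ofId F (QCRing F m)) (Y F m ^ (m - 1)) (by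
    have h : (Y F m ^ (m - 1)) ^ m = 1 := by
      rw [← pow_mul, mul_comm, pow_mul, Y_pow, one_pow]
    simp [h])

variable {F : Type*} [Field F] {m : ℕ}

/-- The Hermitian inner product `⟨x, y⟩ = ∑ x_j * conj y_j` on `R ^ n`. -/
noncomputable def hermInner {n : ℕ} (x y : Fin n → QCRing F m) : QCRing F m :=
  ∑ j, x j * conj F m (y j)

/-- The dual of a linear code over `R` with respect to the Hermitian inner product. -/
noncomputable def hermDual {n : ℕ} (C : Submodule (QCRing F m) (Fin n → QCRing F m)) :
    Submodule (QCRing F m) (Fin n → QCRing F m) where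
  carrier := {x | ∀ y ∈ C, hermInner x y = 0}
  zero_mem' := by intro y _; simp [hermInner]
  add_mem' := by
    intro a b ha hb y hy
    have h1 := ha y hy
    have h2 := hb y hy
    unfold hermInner at h1 h2 ⊢
    simp [add_mul, Finset.sum_add_distrib, h1, h2]
  smul_mem' := by
    intro t a ha y hy
    have h1 := ha y hy
    unfold hermInner at h1 ⊢
    simp [mul_assoc, ← Finset.mul_sum, h1]

/-- Hermitian self-dual codes over `R`. -/
def IsHermSelfDual {n : ℕ} (C : Submodule (QCRing F m) (Fin n → QCRing F m)) : Prop :=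
  C = hermDual C

/-- The matrix `G` of the building-up construction: its first row is `(1, 0 | x)`, and its
further rows are `(y_i, c * y_i | r_i)` with `y_i = - ⟨r_i, x⟩`, where `r_i` is the `i`-th row
of `G₀`. -/
noncomputable def buildUpMatrix {k n : ℕ} (c : QCRing F m) (x : Fin n → QCRing F m)
    (G₀ : Matrix (Fin k) (Fin n) (QCRing F m)) :
    Matrix (Fin (k + 1)) (Fin (n + 2)) (QCRing F m) :=
  Matrix.of (Matrix.vecCons
    (Matrix.vecCons 1 (Matrix.vecCons 0 x))
    (fun i => Matrix.vecCons (-hermInner (G₀ i) x)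
      (Matrix.vecCons (c * -hermInner (G₀ i) x) (G₀ i))))

/-- `C`, of length `2 * ℓ + 2`, is obtained by the building-up construction from a Hermitian
self-dual code `C₀` of length `2 * ℓ`. -/
def IsBuiltUp {ℓ : ℕ} (C : Submodule (QCRing F m) (Fin (2 * ℓ + 2) → QCRing F m)) : Prop :=
  ∃ C₀ : Submodule (QCRing F m) (Fin (2 * ℓ) → QCRing F m), IsHermSelfDual C₀ ∧
    ∃ (k : ℕ) (G₀ : Matrix (Fin k) (Fin (2 * ℓ)) (QCRing F m))
      (c : QCRing F m) (x : Fin (2 * ℓ) → QCRing F m),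
      IsGeneratorMatrix G₀ C₀ ∧ c * conj F m c = -1 ∧ hermInner x x = -1 ∧
        IsGeneratorMatrix (buildUpMatrix c x G₀) C

/-- The map `φ : F ^ (m * n) → R ^ n`. The entry `c_{ij}` (`i < m`, `j < n`) of a word `c` is at
position `i * n + j`, and the `j`-th component of `φ c` is `∑ i, c_{ij} Y ^ i`. -/
noncomputable def phi (F : Type*) [Field F] (m n : ℕ) :
    (Fin (m * n) → F) →ₗ[F] (Fin n → QCRing F m) where
  toFun c := fun j => ∑ i : Fin m, c (finProdFinEquiv (i, j)) • Y F m ^ (i : ℕ)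
  map_add' := by
    intro a b
    funext j
    simp [add_smul, Finset.sum_add_distrib]
  map_smul' := by
    intro t a
    funext j
    simp [mul_smul, Finset.smul_sum]

/-- The code `φ⁻¹(E)` over `F` (the map `φ` is bijective for `m ≥ 1`). -/
noncomputable def phiInv {n : ℕ} (E : Submodule (QCRing F m) (Fin n → QCRing F m)) :
    Submodule F (Fin (m * n) → F) :=
  (E.restrictScalars F).comap (phi F m n)

end Ring

end QuasiCyclic

/-!
Write `R = F[Y] / (Y ^ p - 1)`. A self-dual code `C` over `R` is built up from a shorter one as soon
as it contains a word `(1, 0, x)`. Indeed, `⟨x, x⟩ = -1` by self-orthogonality, and subtracting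
multiples of this word from the others shows that `C` is generated by it and by the words of the
form `(y, c y, r)`; orthogonality to `(1, 0, x)` forces `y = -⟨r, x⟩`. Since `c * conj c = -1`, the
map `r ↦ (y, c y, r)` (`buildUpRow`) is an isometry, so the code of all such `r` is self-dual
(`isBuiltUp_of_mem`). A suitable `c` is a square root of `-1` in `F`.

It remains to find two coordinates `i ≠ j` and a word `v ∈ C` with `v i = 1` and `v j = 0`. As `q` is
primitive modulo `p`, the cyclotomic polynomial `Φ_p` is irreducible over `F`, so that `R` is the
product of two fields, given by two orthogonal idempotents fixed by the conjugation
(`IsConjFieldIdempotent`). On such a component, the absence of a word with `v i = e` and `v j = 0`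
makes the coordinates `i` and `j` proportional, and then self-duality puts a word of weight two with
support `{i, j}` into the code. Two such words with supports `{i, j}` and `{i, k}` are not
orthogonal, so each of the two components spoils at most one `j` for a given `i`
(`IsConjFieldIdempotent.eq_zero_of_proportional`). For length at least `4` there are three
candidates for `j`, and one of them is good for both components.

For quasi-cyclic codes, `phi` turns the `n`-fold shift into the multiplication by `Y`, and the
coefficient of `Y ^ 0` of the Hermitian form is the Euclidean form. Hence a Euclidean self-dual code
corresponds to a Hermitian self-dual code over `R` (`IsQuasiCyclic.isHermSelfDual_code`). Its length
`n` is even because its image under `Y ↦ 1` is a Euclidean self-dual code of length `n` over `F`;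
unlike the count of dimensions over `F`, this argument also covers `p = 2`.
-/

namespace QuasiCyclic

/-! ### The Hermitian inner product -/

section Hermitian

variable {F : Type*} [Field F] {m n : ℕ}

theorem hermInner_add_left (x y z : Fin n → QCRing F m) :
    hermInner (x + y) z = hermInner x z + hermInner y z := by
  simp [hermInner, add_mul, Finset.sum_add_distrib]

theorem hermInner_smul_left (t : QCRing F m) (x z : Fin n → QCRing F m) :
    hermInner (t • x) z = t * hermInner x z := by
  simp [hermInner, mul_assoc, Finset.mul_sum]

theorem hermInner_sub_left (x y z : Fin n → QCRing F m) :
    hermInner (x - y) z = hermInner x z - hermInner y z := by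
  simp [hermInner, sub_mul, Finset.sum_sub_distrib]

theorem hermInner_add_right (x y z : Fin n → QCRing F m) :
    hermInner x (y + z) = hermInner x y + hermInner x z := by
  simp [hermInner, mul_add, Finset.sum_add_distrib]

theorem hermInner_smul_right (t : QCRing F m) (x z : Fin n → QCRing F m) :
    hermInner x (t • z) = conj F m t * hermInner x z := by
  simp only [hermInner, Pi.smul_apply, smul_eq_mul, map_mul, Finset.mul_sum]
  exact Finset.sum_congr rfl fun j _ => by ring

theorem hermInner_single_left (i : Fin n) (a : QCRing F m) (y : Fin n → QCRing F m) :
    hermInner (Pi.single i a) y = a * conj F m (y i) := by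
  rw [hermInner, Finset.sum_eq_single i]
  · simp
  · intro j _ hj
    simp [Pi.single_eq_of_ne hj]
  · simp

theorem hermInner_vecCons (a b : QCRing F m) (x y : Fin n → QCRing F m) :
    hermInner (Matrix.vecCons a x) (Matrix.vecCons b y) = a * conj F m b + hermInner x y := by
  simp [hermInner, Fin.sum_univ_succ]

theorem hermInner_comp_equiv {n' : ℕ} (e : Fin n' ≃ Fin n) (x y : Fin n → QCRing F m) :
    hermInner (x ∘ e) (y ∘ e) = hermInner x y :=
  Equiv.sum_comp e fun j => x j * conj F m (y j)

theorem IsHermSelfDual.mem_iff {C : Submodule (QCRing F m) (Fin n → QCRing F m)}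
    (hC : IsHermSelfDual C) {x : Fin n → QCRing F m} :
    x ∈ C ↔ ∀ y ∈ C, hermInner x y = 0 := by
  conv_lhs => rw [show C = hermDual C from hC]
  rfl

theorem IsHermSelfDual.map_funCongrLeft {n' : ℕ}
    {C : Submodule (QCRing F m) (Fin n → QCRing F m)} (hC : IsHermSelfDual C)
    (e : Fin n' ≃ Fin n) :
    IsHermSelfDual (C.map (LinearEquiv.funCongrLeft (QCRing F m) (QCRing F m) e).toLinearMap) := by
  ext x
  constructor
  · rintro ⟨v, hv, rfl⟩ _ ⟨w, hw, rfl⟩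
    exact (hermInner_comp_equiv e v w).trans (hC.mem_iff.1 hv w hw)
  · intro hx
    have hxe : (x ∘ e.symm) ∘ e = x := by
      ext j
      simp
    refine ⟨x ∘ e.symm, hC.mem_iff.2 fun w hw => ?_, hxe⟩
    have h := hx (w ∘ e) ⟨w, hw, rfl⟩
    rw [← hxe, hermInner_comp_equiv] at h
    exact h

end Hermitian

/-! ### Codewords with a prescribed unit and a prescribed zero -/

section Idempotent

variable {F : Type*} [Field F] {m n : ℕ}

/-- `e` is a conjugation-invariant idempotent of `R` such that `R e` is a field, in the sense that
every nonzero element of `R e` divides `e`. The degenerate value `e = 0` is not excluded. -/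
structure IsConjFieldIdempotent (e : QCRing F m) : Prop where
  mul_self : e * e = e
  conj_eq : conj F m e = e
  exists_mul_eq : ∀ a, a * e ≠ 0 → ∃ b, b * (a * e) = e

variable {e : QCRing F m} {C : Submodule (QCRing F m) (Fin n → QCRing F m)}

/-- If, on the component `e C`, the vanishing of the `j`-th coordinate forces that of the `i`-th
one, then the two coordinates are proportional on `e C`, and self-duality puts the corresponding
vector of weight two into `C`. -/
theorem IsConjFieldIdempotent.exists_single_sub_mem (he : IsConjFieldIdempotent e)
    (hC : IsHermSelfDual C) {i j : Fin n} (h : ∀ v ∈ C, v j * e = 0 → v i * e = 0) :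
    ∃ a : QCRing F m, Pi.single i e - a • Pi.single j e ∈ C := by
  obtain ⟨a, ha⟩ : ∃ a : QCRing F m, ∀ v ∈ C, v i * e = a * (v j * e) := by
    by_cases h0 : ∀ v ∈ C, v j * e = 0
    · exact ⟨0, fun v hv => by simp [h v hv (h0 v hv)]⟩
    · push Not at h0
      obtain ⟨w, hw, hwj⟩ := h0
      obtain ⟨b, hb⟩ := he.exists_mul_eq _ hwj
      -- `w` is scaled so that its `j`-th coordinate becomes the unit `e` of `R e`.
      refine ⟨b * w i, fun v hv => ?_⟩
      have hmem : v - (v j * b) • w ∈ C := C.sub_mem hv (C.smul_mem _ hw)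
      have hz := h _ hmem (by
        simp only [Pi.sub_apply, Pi.smul_apply, smul_eq_mul]
        linear_combination -v j * hb)
      simp only [Pi.sub_apply, Pi.smul_apply, smul_eq_mul] at hz
      linear_combination hz
  refine ⟨conj F m a, hC.mem_iff.2 fun v hv => ?_⟩
  have hv' := congrArg (conj F m) (ha v hv)
  simp only [map_mul, he.conj_eq] at hv'
  rw [hermInner_sub_left, hermInner_smul_left, hermInner_single_left, hermInner_single_left]
  linear_combination hv'

/-- A coordinate is proportional to at most one other coordinate on a nonzero component of a
self-dual code: two vectors of weight two whose supports share one position are not orthogonal. -/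
theorem IsConjFieldIdempotent.eq_zero_of_proportional (he : IsConjFieldIdempotent e)
    (hC : IsHermSelfDual C) {i j k : Fin n} (hij : i ≠ j) (hik : i ≠ k) (hjk : j ≠ k)
    (hj : ∀ v ∈ C, v j * e = 0 → v i * e = 0) (hk : ∀ v ∈ C, v k * e = 0 → v i * e = 0) :
    e = 0 := by
  obtain ⟨a, ha⟩ := he.exists_single_sub_mem hC hj
  obtain ⟨b, hb⟩ := he.exists_single_sub_mem hC hk
  have h := hC.mem_iff.1 ha _ hb
  rw [hermInner_sub_left, hermInner_smul_left, hermInner_single_left, hermInner_single_left] at h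
  simpa [hij, hij.symm, hik, hik.symm, hjk, hjk.symm, he.conj_eq, he.mul_self] using h

theorem IsConjFieldIdempotent.exists_mem_or_exists_mem (he : IsConjFieldIdempotent e)
    (hC : IsHermSelfDual C) {i j k : Fin n} (hij : i ≠ j) (hik : i ≠ k) (hjk : j ≠ k) :
    (∃ v ∈ C, v i = e ∧ v j = 0) ∨ ∃ v ∈ C, v i = e ∧ v k = 0 := by
  have key : ∀ l : Fin n, (¬∃ v ∈ C, v i = e ∧ v l = 0) →
      ∀ v ∈ C, v l * e = 0 → v i * e = 0 := by
    intro l hl v hv hvl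
    by_contra hvi
    obtain ⟨b, hb⟩ := he.exists_mul_eq _ hvi
    refine hl ⟨(b * e) • v, C.smul_mem _ hv, ?_, ?_⟩
    · simp only [Pi.smul_apply, smul_eq_mul]
      linear_combination hb
    · simp only [Pi.smul_apply, smul_eq_mul]
      linear_combination b * hvl
  by_contra hne
  rw [not_or] at hne
  have h0 := he.eq_zero_of_proportional hC hij hik hjk (key j hne.1) (key k hne.2)
  exact hne.1 ⟨0, C.zero_mem, by simp [h0], rfl⟩

/-- Each of the two components spoils at most one of the three pairs of coordinates that
consist of a fixed position and one of three others, so that one of these pairs is good for both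
components. -/
theorem IsHermSelfDual.exists_mem_eq_one_eq_zero {e₁ e₂ : QCRing F m}
    (h₁ : IsConjFieldIdempotent e₁) (h₂ : IsConjFieldIdempotent e₂) (h : e₁ + e₂ = 1)
    (hC : IsHermSelfDual C) (hn : 4 ≤ n) :
    ∃ i j : Fin n, i ≠ j ∧ ∃ v ∈ C, v i = 1 ∧ v j = 0 := by
  have combine : ∀ i j : Fin n, i ≠ j → (∃ v ∈ C, v i = e₁ ∧ v j = 0) →
      (∃ v ∈ C, v i = e₂ ∧ v j = 0) → ∃ i j : Fin n, i ≠ j ∧ ∃ v ∈ C, v i = 1 ∧ v j = 0 := by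
    rintro i j hij ⟨v, hv, hv1, hv0⟩ ⟨w, hw, hw1, hw0⟩
    exact ⟨i, j, hij, v + w, C.add_mem hv hw, by simp [hv1, hw1, h], by simp [hv0, hw0]⟩
  obtain ⟨i, j, k, l, hij, hik, hil, hjk, hjl, hkl⟩ : ∃ i j k l : Fin n,
      i ≠ j ∧ i ≠ k ∧ i ≠ l ∧ j ≠ k ∧ j ≠ l ∧ k ≠ l :=
    ⟨⟨0, by omega⟩, ⟨1, by omega⟩, ⟨2, by omega⟩, ⟨3, by omega⟩, by simp⟩
  have pigeonhole : ∀ {a₁ a₂ a₃ b₁ b₂ b₃ : Prop}, a₁ ∨ a₂ → a₁ ∨ a₃ → a₂ ∨ a₃ →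
      b₁ ∨ b₂ → b₁ ∨ b₃ → b₂ ∨ b₃ → a₁ ∧ b₁ ∨ a₂ ∧ b₂ ∨ a₃ ∧ b₃ := by tauto
  rcases pigeonhole (h₁.exists_mem_or_exists_mem hC hij hik hjk)
    (h₁.exists_mem_or_exists_mem hC hij hil hjl) (h₁.exists_mem_or_exists_mem hC hik hil hkl)
    (h₂.exists_mem_or_exists_mem hC hij hik hjk) (h₂.exists_mem_or_exists_mem hC hij hil hjl)
    (h₂.exists_mem_or_exists_mem hC hik hil hkl) with h | h | h
  · exact combine i j hij h.1 h.2
  · exact combine i k hik h.1 h.2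
  · exact combine i l hil h.1 h.2

end Idempotent

/-! ### Recognizing a built-up code -/

section BuildUp

variable {F : Type*} [Field F] {m n : ℕ}

/-- The linear map `r ↦ (y, c y, r)` with `y = -⟨r, x⟩`, whose values at the rows of a generator
matrix are the lower rows of the matrix of the building-up construction. -/
noncomputable def buildUpRow (c : QCRing F m) (x : Fin n → QCRing F m) :
    (Fin n → QCRing F m) →ₗ[QCRing F m] (Fin (n + 2) → QCRing F m) where
  toFun r := Matrix.vecCons (-hermInner r x) (Matrix.vecCons (c * -hermInner r x) r)
  map_add' r s := by
    rw [hermInner_add_left, Matrix.cons_add_cons, Matrix.cons_add_cons]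
    congr 2 <;> ring
  map_smul' t r := by
    rw [hermInner_smul_left, RingHom.id_apply, Matrix.smul_cons, Matrix.smul_cons]
    simp only [smul_eq_mul]
    congr 2 <;> ring

theorem buildUpRow_apply (c : QCRing F m) (x r : Fin n → QCRing F m) :
    buildUpRow c x r = Matrix.vecCons (-hermInner r x) (Matrix.vecCons (c * -hermInner r x) r) :=
  rfl

/-- The map `buildUpRow` is an isometry when `c * conj c = -1`. -/
theorem hermInner_buildUpRow {c : QCRing F m} (hc : c * conj F m c = -1)
    (x r s : Fin n → QCRing F m) :
    hermInner (buildUpRow c x r) (buildUpRow c x s) = hermInner r s := by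
  simp only [buildUpRow_apply, hermInner_vecCons, map_mul, map_neg]
  linear_combination (hermInner r x * conj F m (hermInner s x)) * hc

theorem hermInner_buildUpRow_vecCons (c : QCRing F m) (x r : Fin n → QCRing F m) :
    hermInner (buildUpRow c x r) (Matrix.vecCons 1 (Matrix.vecCons 0 x)) = 0 := by
  simp [buildUpRow_apply, hermInner_vecCons]

variable {C : Submodule (QCRing F m) (Fin (n + 2) → QCRing F m)}

/-- A self-dual code containing `(1, 0, x)` is the sum of the line spanned by this word and
of the words `(y, c y, r)` with `y = -⟨r, x⟩`: subtracting the multiple `v₀ + conj c * v₁` of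
`(1, 0, x)` achieves the relation between the first two coordinates. -/
theorem exists_eq_smul_add_buildUpRow (hC : IsHermSelfDual C) {c : QCRing F m}
    (hc : c * conj F m c = -1) {x : Fin n → QCRing F m}
    (hx : Matrix.vecCons 1 (Matrix.vecCons 0 x) ∈ C) {v : Fin (n + 2) → QCRing F m} (hv : v ∈ C) :
    ∃ (t : QCRing F m) (s : Fin n → QCRing F m),
      v = t • Matrix.vecCons 1 (Matrix.vecCons 0 x) + buildUpRow c x s := by
  obtain ⟨a, w, rfl⟩ : ∃ a w, v = Matrix.vecCons a w :=
    ⟨_, _, (Matrix.cons_head_tail v).symm⟩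
  obtain ⟨b, r, rfl⟩ : ∃ b r, w = Matrix.vecCons b r :=
    ⟨_, _, (Matrix.cons_head_tail w).symm⟩
  have h1 := hC.mem_iff.1 hv _ hx
  have h2 := hC.mem_iff.1 hx _ hx
  simp only [hermInner_vecCons, map_one, map_zero, mul_one, mul_zero, zero_add] at h1 h2
  refine ⟨a + conj F m c * b, r - (a + conj F m c * b) • x, ?_⟩
  have hy : -hermInner (r - (a + conj F m c * b) • x) x = -(conj F m c * b) := by
    rw [hermInner_sub_left, hermInner_smul_left]
    linear_combination (a + conj F m c * b) * h2 - h1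
  rw [buildUpRow_apply, hy, Matrix.smul_cons, Matrix.smul_cons, Matrix.cons_add_cons,
    Matrix.cons_add_cons]
  simp only [smul_eq_mul]
  congr 1
  · ring
  congr 1
  · linear_combination b * hc
  · abel

/-- A self-dual code containing `(1, 0, x)` is built up from the code of all `r` such that
`(y, c y, r)` with `y = -⟨r, x⟩` is one of its words. -/
theorem isBuiltUp_of_mem {ℓ : ℕ}
    {C : Submodule (QCRing F m) (Fin (2 * ℓ + 2) → QCRing F m)} (hC : IsHermSelfDual C)
    {c : QCRing F m} (hc : c * conj F m c = -1) {x : Fin (2 * ℓ) → QCRing F m}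
    (hx : Matrix.vecCons 1 (Matrix.vecCons 0 x) ∈ C) : IsBuiltUp C := by
  have hL : ∀ {t : QCRing F m} {s : Fin (2 * ℓ) → QCRing F m},
      t • Matrix.vecCons 1 (Matrix.vecCons 0 x) + buildUpRow c x s ∈ C →
      buildUpRow c x s ∈ C := fun h => (C.add_mem_iff_right (C.smul_mem _ hx)).1 h
  obtain ⟨k, G, hG⟩ := Submodule.fg_iff_exists_fin_generating_family.1
    (IsNoetherian.noetherian (C.comap (buildUpRow c x)))
  refine ⟨C.comap (buildUpRow c x), ?_, k, G, c, x, hG, hc, ?_, ?_⟩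
  · ext r
    constructor
    · intro hr s hs
      rw [← hermInner_buildUpRow hc x]
      exact hC.mem_iff.1 hr _ hs
    · intro hr
      refine hC.mem_iff.2 fun v hv => ?_
      obtain ⟨t, s, rfl⟩ := exists_eq_smul_add_buildUpRow hC hc hx hv
      rw [hermInner_add_right, hermInner_smul_right, hermInner_buildUpRow_vecCons,
        hermInner_buildUpRow hc, hr s (hL hv), mul_zero, add_zero]
  · have h2 := hC.mem_iff.1 hx _ hx
    simp only [hermInner_vecCons, map_one, map_zero, mul_one, mul_zero, zero_add] at h2
    linear_combination h2
  · apply le_antisymm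
    · rw [Submodule.span_le]
      rintro _ ⟨i, rfl⟩
      refine Fin.cases hx (fun i => ?_) i
      exact hG.le (Submodule.subset_span ⟨i, rfl⟩)
    · intro v hv
      obtain ⟨t, s, rfl⟩ := exists_eq_smul_add_buildUpRow hC hc hx hv
      refine Submodule.add_mem _ (Submodule.smul_mem _ _ (Submodule.subset_span ⟨0, rfl⟩)) ?_
      have hle : C.comap (buildUpRow c x) ≤ (Submodule.span _ (Set.range fun i =>
          buildUpMatrix c x G i)).comap (buildUpRow c x) := by
        rw [← hG, Submodule.span_le]
        rintro _ ⟨i, rfl⟩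
        exact Submodule.subset_span ⟨i.succ, rfl⟩
      exact hle (hL hv)

/-- A permutation of the coordinates moves the positions of the `1` and of the `0` to the front. -/
theorem IsHermSelfDual.exists_isBuiltUp_permEquivalent {ℓ : ℕ}
    {C : Submodule (QCRing F m) (Fin (2 * ℓ + 2) → QCRing F m)} (hC : IsHermSelfDual C)
    {c : QCRing F m} (hc : c * conj F m c = -1) {i j : Fin (2 * ℓ + 2)} (hij : i ≠ j)
    {v : Fin (2 * ℓ + 2) → QCRing F m} (hv : v ∈ C) (hvi : v i = 1) (hvj : v j = 0) :
    ∃ C' : Submodule (QCRing F m) (Fin (2 * ℓ + 2) → QCRing F m),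
      IsBuiltUp C' ∧ PermEquivalent C' C := by
  obtain ⟨σ, h0, h1⟩ : ∃ σ : Equiv.Perm (Fin (2 * ℓ + 2)), σ 0 = i ∧ σ 1 = j := by
    refine ⟨Equiv.swap 0 i * Equiv.swap 1 (Equiv.swap 0 i j), ?_, ?_⟩
    · have : (0 : Fin (2 * ℓ + 2)) ≠ Equiv.swap 0 i j := by
        intro h
        rw [eq_comm, Equiv.swap_apply_eq_iff, Equiv.swap_apply_left] at h
        exact hij h.symm
      rw [Equiv.Perm.mul_apply, Equiv.swap_apply_of_ne_of_ne (by simp) this, Equiv.swap_apply_left]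
    · simp
  refine ⟨_, isBuiltUp_of_mem (hC.map_funCongrLeft σ) hc
    (x := fun k => v (σ k.succ.succ)) ⟨v, hv, ?_⟩, σ.symm, ?_⟩
  · ext k
    refine Fin.cases ?_ (fun k => Fin.cases ?_ (fun k => ?_) k) k
    · exact congrArg v h0 |>.trans hvi
    · exact congrArg v h1 |>.trans hvj
    · rfl
  · ext w
    constructor
    · intro hw
      refine ⟨w ∘ σ, ⟨w, hw, rfl⟩, ?_⟩
      ext k
      simp [LinearMap.funLeft]
    · rintro ⟨_, ⟨u, hu, rfl⟩, rfl⟩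
      have hu' : (u ∘ σ) ∘ σ.symm = u := by
        ext k
        simp
      have hmem : (u ∘ σ) ∘ σ.symm ∈ C := by rwa [hu']
      exact hmem

end BuildUp

/-! ### The two components of `F[Y] / (Y ^ p - 1)` -/

section Components

variable {F : Type*} [Field F] {m : ℕ}

theorem conj_Y : conj F m (Y F m) = Y F m ^ (m - 1) := by
  simp [conj, Y]

/-- The augmentation `R → F`, the `F`-algebra homomorphism with `Y ↦ 1`. -/
noncomputable def augmentation (F : Type*) [Field F] (m : ℕ) : QCRing F m →ₐ[F] F :=
  AdjoinRoot.liftAlgHom (X ^ m - 1 : F[X]) (Algebra.ofId F F) 1 (by simp)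

theorem augmentation_Y : augmentation F m (Y F m) = 1 := by
  simp [augmentation, Y]

theorem augmentation_conj (a : QCRing F m) :
    augmentation F m (conj F m a) = augmentation F m a := by
  have h : (augmentation F m).comp (conj F m) = augmentation F m := by
    apply AdjoinRoot.algHom_ext
    change augmentation F m (conj F m (Y F m)) = augmentation F m (Y F m)
    rw [conj_Y, map_pow, augmentation_Y, one_pow]
  exact DFunLike.congr_fun h a

/-- The element `1 + Y + ⋯ + Y ^ (m - 1)` of `R`. -/
noncomputable def geomElement (F : Type*) [Field F] (m : ℕ) : QCRing F m :=
  ∑ i ∈ Finset.range m, Y F m ^ i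

theorem Y_mul_geomElement : Y F m * geomElement F m = geomElement F m := by
  have h := mul_geom_sum (Y F m) m
  rw [Y_pow, sub_self] at h
  unfold geomElement
  linear_combination h

/-- On the component of `geomElement`, every element of `R` acts through the augmentation. -/
theorem mul_geomElement (a : QCRing F m) :
    a * geomElement F m = algebraMap F _ (augmentation F m a) * geomElement F m := by
  induction a using AdjoinRoot.induction_on with
  | ih f =>
    induction f using Polynomial.induction_on' with
    | add f g hf hg => simp only [map_add, add_mul, hf, hg]
    | monomial k c =>
      have hY : Y F m ^ k * geomElement F m = geomElement F m := by
        induction k with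
        | zero => simp
        | succ k ih => rw [pow_succ, mul_assoc, Y_mul_geomElement, ih]
      have hmk : AdjoinRoot.mk (X ^ m - 1 : F[X]) (monomial k c)
          = algebraMap F (QCRing F m) c * Y F m ^ k := by
        rw [← C_mul_X_pow_eq_monomial, map_mul, map_pow, AdjoinRoot.mk_X]
        rfl
      rw [hmk, map_mul, map_pow, augmentation_Y, one_pow, mul_one, AlgHom.commutes, mul_assoc, hY]
      rfl

theorem augmentation_geomElement : augmentation F m (geomElement F m) = m := by
  simp [geomElement, augmentation_Y]

theorem conj_geomElement : conj F m (geomElement F m) = geomElement F m := by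
  have h : Y F m ^ (m - 1) * conj F m (geomElement F m) = geomElement F m := by
    conv_rhs => rw [geomElement, ← Finset.sum_range_reflect]
    rw [geomElement, map_sum, Finset.mul_sum]
    refine Finset.sum_congr rfl fun i hi => ?_
    have hi' : m - 1 + (m - 1) * i = m * i + (m - 1 - i) := by
      obtain ⟨k, rfl⟩ : ∃ k, m = i + k + 1 :=
        ⟨m - i - 1, by have := Finset.mem_range.1 hi; omega⟩
      simp only [Nat.add_sub_cancel, Nat.add_sub_cancel_left]
      ring
    rw [map_pow, conj_Y, ← pow_mul, ← pow_add, hi', pow_add, pow_mul, Y_pow, one_pow, one_mul]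
  rcases Nat.eq_zero_or_pos m with rfl | hm
  · simp [geomElement]
  · have hY : Y F m * Y F m ^ (m - 1) = 1 := by
      rw [← pow_succ', Nat.sub_add_cancel hm, Y_pow]
    calc conj F m (geomElement F m)
        = Y F m * (Y F m ^ (m - 1) * conj F m (geomElement F m)) := by
          rw [← mul_assoc, hY, one_mul]
      _ = geomElement F m := by rw [h, Y_mul_geomElement]

/-- The idempotent of the component `R / (Y - 1)` of `R`. It is meant for `m ≠ 0` in `F` only. -/
noncomputable def trivialIdempotent (F : Type*) [Field F] (m : ℕ) : QCRing F m :=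
  algebraMap F _ (m : F)⁻¹ * geomElement F m

theorem augmentation_trivialIdempotent (hm : (m : F) ≠ 0) :
    augmentation F m (trivialIdempotent F m) = 1 := by
  rw [trivialIdempotent, map_mul, AlgHom.commutes, augmentation_geomElement]
  exact inv_mul_cancel₀ hm

theorem mul_trivialIdempotent (a : QCRing F m) :
    a * trivialIdempotent F m = algebraMap F _ (augmentation F m a) * trivialIdempotent F m := by
  unfold trivialIdempotent
  linear_combination algebraMap F (QCRing F m) (m : F)⁻¹ * mul_geomElement a

theorem conj_trivialIdempotent :
    conj F m (trivialIdempotent F m) = trivialIdempotent F m := by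
  rw [trivialIdempotent, map_mul, AlgHom.commutes, conj_geomElement]

theorem trivialIdempotent_mul_self (hm : (m : F) ≠ 0) :
    trivialIdempotent F m * trivialIdempotent F m = trivialIdempotent F m := by
  rw [mul_trivialIdempotent, augmentation_trivialIdempotent hm, map_one, one_mul]

theorem isConjFieldIdempotent_trivialIdempotent (hm : (m : F) ≠ 0) :
    IsConjFieldIdempotent (trivialIdempotent F m) where
  mul_self := trivialIdempotent_mul_self hm
  conj_eq := conj_trivialIdempotent
  exists_mul_eq a ha := by
    rw [mul_trivialIdempotent] at ha ⊢
    have h0 : augmentation F m a ≠ 0 := by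
      intro h
      simp [h] at ha
    refine ⟨algebraMap F _ (augmentation F m a)⁻¹, ?_⟩
    rw [← mul_assoc, ← map_mul, inv_mul_cancel₀ h0, map_one, one_mul]

theorem geomElement_mul_one_sub (hm : (m : F) ≠ 0) :
    geomElement F m * (1 - trivialIdempotent F m) = 0 := by
  rw [mul_sub, mul_trivialIdempotent, augmentation_geomElement, trivialIdempotent, ← mul_assoc,
    ← map_mul, mul_inv_cancel₀ hm, map_one, one_mul, mul_one, sub_self]

/-- The complementary component of `R` is `F[Y] / Φ_p`, which is a field if the cyclotomic
polynomial `Φ_p` is irreducible. -/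
theorem isConjFieldIdempotent_one_sub {p : ℕ} (hp : p.Prime) (hpF : (p : F) ≠ 0)
    (hirr : Irreducible (cyclotomic p F)) :
    IsConjFieldIdempotent (1 - trivialIdempotent F p) where
  mul_self := by linear_combination trivialIdempotent_mul_self hpF
  conj_eq := by rw [map_sub, map_one, conj_trivialIdempotent]
  exists_mul_eq a ha := by
    induction a using AdjoinRoot.induction_on with
    | ih f =>
      have : Fact p.Prime := ⟨hp⟩
      have hΦ : AdjoinRoot.mk (X ^ p - 1 : F[X]) (cyclotomic p F) = geomElement F p := by
        rw [cyclotomic_prime, map_sum]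
        simp only [map_pow, AdjoinRoot.mk_X]
        rfl
      have h0 := geomElement_mul_one_sub hpF
      rw [← hΦ] at h0
      rcases (hirr.isCoprime_or_dvd f).symm with ⟨g, rfl⟩ | hco
      · refine absurd ?_ ha
        rw [map_mul]
        linear_combination AdjoinRoot.mk _ g * h0
      · obtain ⟨u, v, huv⟩ := hco
        have huv' := congrArg (AdjoinRoot.mk (X ^ p - 1 : F[X])) huv
        rw [map_add, map_mul, map_mul, map_one] at huv'
        refine ⟨AdjoinRoot.mk _ v, ?_⟩
        linear_combination (1 - trivialIdempotent F p) * huv' - AdjoinRoot.mk _ u * h0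

end Components

section FiniteField

variable {F : Type*} [Field F] [Fintype F] {p : ℕ}

/-- The prime `p` is not the characteristic of `F`: otherwise `q` would vanish modulo `p`. -/
theorem IsPrimitiveElementMod.natCast_ne_zero (hp : p.Prime)
    (hq : IsPrimitiveElementMod (Fintype.card F) p) : (p : F) ≠ 0 := by
  have : Fact p.Prime := ⟨hp⟩
  obtain ⟨u, hu, -⟩ := hq
  obtain ⟨r, hr⟩ := CharP.exists F
  obtain ⟨n, hr', hn⟩ := FiniteField.card F r
  intro h
  have hrp : r = p := (Nat.prime_dvd_prime_iff_eq hr' hp).1 ((CharP.cast_eq_zero_iff F r p).1 h)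
  refine u.ne_zero ?_
  rw [hu, hn, hrp]
  simp

/-- Every irreducible factor of `Φ_p` over `F` has the order of `q` modulo `p` as its degree, and
this is `p - 1` for a primitive element `q`. -/
theorem IsPrimitiveElementMod.irreducible_cyclotomic (hp : p.Prime)
    (hq : IsPrimitiveElementMod (Fintype.card F) p) : Irreducible (cyclotomic p F) := by
  have hpF := hq.natCast_ne_zero hp
  have : Fact p.Prime := ⟨hp⟩
  obtain ⟨u, hu, hgen⟩ := hq
  obtain ⟨r, hr⟩ := CharP.exists F
  obtain ⟨n, hr', hn⟩ := FiniteField.card F r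
  have : Fact r.Prime := ⟨hr'⟩
  have hco : r.Coprime p :=
    hr'.coprime_iff_not_dvd.2 fun h => hpF ((CharP.cast_eq_zero_iff F r p).2 h)
  refine irreducible_of_dvd_cyclotomic_of_natDegree hn hco dvd_rfl ?_
  have hu' : ZMod.unitOfCoprime _ (hco.pow_left (n : ℕ)) = u := by
    ext
    rw [ZMod.coe_unitOfCoprime, hu, hn]
  rw [hu', orderOf_eq_card_of_forall_mem_zpowers hgen, natDegree_cyclotomic, Nat.card_eq_fintype_card,
    ZMod.card_units_eq_totient]

/-- Any square root of `-1` in `F` is fixed by the conjugation. -/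
theorem exists_mul_conj_eq_neg_one (m : ℕ)
    (hF : CharP F 2 ∨ Fintype.card F ≡ 1 [MOD 4]) : ∃ c : QCRing F m, c * conj F m c = -1 := by
  have hsq : IsSquare (-1 : F) := by
    rcases hF with h2 | h1
    · rw [CharTwo.neg_eq]
      exact IsSquare.one
    · rw [FiniteField.isSquare_neg_one_iff]
      have : Fintype.card F % 4 = 1 % 4 := h1
      omega
  obtain ⟨i, hi⟩ := hsq
  refine ⟨algebraMap F _ i, ?_⟩
  rw [AlgHom.commutes, ← map_mul, ← hi, map_neg, map_one]

theorem IsHermSelfDual.exists_permEquivalent_isBuiltUp (hp : p.Prime)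
    (hF : CharP F 2 ∨ Fintype.card F ≡ 1 [MOD 4])
    (hq : IsPrimitiveElementMod (Fintype.card F) p) {ℓ : ℕ} (hℓ : 1 ≤ ℓ)
    {C : Submodule (QCRing F p) (Fin (2 * ℓ + 2) → QCRing F p)} (hC : IsHermSelfDual C) :
    ∃ C' : Submodule (QCRing F p) (Fin (2 * ℓ + 2) → QCRing F p),
      IsBuiltUp C' ∧ PermEquivalent C' C := by
  obtain ⟨c, hc⟩ := exists_mul_conj_eq_neg_one p hF
  have hpF := hq.natCast_ne_zero hp
  obtain ⟨i, j, hij, v, hv, hvi, hvj⟩ := hC.exists_mem_eq_one_eq_zero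
    (isConjFieldIdempotent_trivialIdempotent hpF)
    (isConjFieldIdempotent_one_sub hp hpF (hq.irreducible_cyclotomic hp))
    (add_sub_cancel _ _) (by omega)
  exact hC.exists_isBuiltUp_permEquivalent hc hij hv hvi hvj

end FiniteField

/-! ### Self-dual codes have even length -/

section EvenLength

variable {F : Type*} [Field F] {m n : ℕ}

theorem IsEuclideanSelfDual.mem_iff {D : Submodule F (Fin n → F)} (hD : IsEuclideanSelfDual D)
    {x : Fin n → F} : x ∈ D ↔ ∀ y ∈ D, ∑ j, x j * y j = 0 := by
  conv_lhs => rw [show D = euclideanDual D from hD]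
  rfl

theorem IsEuclideanSelfDual.even_length {D : Submodule F (Fin n → F)}
    (hD : IsEuclideanSelfDual D) : Even n := by
  let B : LinearMap.BilinForm F (Fin n → F) := dotProductBilin F F
  have hB : LinearMap.ker B = ⊥ := by
    refine LinearMap.ker_eq_bot'.2 fun x hx => funext fun i => ?_
    simpa [B, dotProductBilin] using LinearMap.congr_fun hx (Pi.single i 1)
  have hDB : B.orthogonal D = D := by
    ext x
    rw [LinearMap.BilinForm.mem_orthogonal_iff, hD.mem_iff]
    refine forall₂_congr fun y _ => ?_
    change y ⬝ᵥ x = 0 ↔ x ⬝ᵥ y = 0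
    rw [dotProduct_comm]
  have h := LinearMap.BilinForm.finrank_add_finrank_orthogonal' (B := B) D
  rw [hDB, hB, inf_bot_eq, finrank_bot, add_zero, Module.finrank_fin_fun] at h
  exact ⟨_, h.symm⟩

/-- The code over `F` obtained from a code over `R` by the augmentation in each coordinate. -/
noncomputable def augmentationCode (C : Submodule (QCRing F m) (Fin n → QCRing F m)) :
    Submodule F (Fin n → F) :=
  (C.restrictScalars F).map ((augmentation F m).toLinearMap.compLeft (Fin n))

theorem IsHermSelfDual.isEuclideanSelfDual_augmentationCode (hm : (m : F) ≠ 0)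
    {C : Submodule (QCRing F m) (Fin n → QCRing F m)} (hC : IsHermSelfDual C) :
    IsEuclideanSelfDual (augmentationCode C) := by
  ext u
  constructor
  · rintro ⟨v, hv, rfl⟩ _ ⟨w, hw, rfl⟩
    have h := congrArg (augmentation F m) (hC.mem_iff.1 hv w hw)
    simpa [hermInner, augmentation_conj] using h
  · intro hu
    -- A word orthogonal to the image is lifted into the component of the trivial idempotent.
    refine ⟨fun j => algebraMap F _ (u j) * trivialIdempotent F m, hC.mem_iff.2 fun v hv => ?_, ?_⟩
    · have h := hu _ ⟨v, hv, rfl⟩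
      have h' : ∀ j, algebraMap F (QCRing F m) (u j) * trivialIdempotent F m * conj F m (v j)
          = algebraMap F (QCRing F m) (u j * augmentation F m (v j)) * trivialIdempotent F m := by
        intro j
        have := mul_trivialIdempotent (conj F m (v j))
        rw [augmentation_conj] at this
        rw [map_mul]
        linear_combination algebraMap F (QCRing F m) (u j) * this
      rw [hermInner, Finset.sum_congr rfl fun j _ => h' j, ← Finset.sum_mul, ← map_sum]
      simp only [LinearMap.compLeft_apply, Function.comp_apply, AlgHom.toLinearMap_apply] at h
      rw [h, map_zero, zero_mul]
    · ext j
      simp only [LinearMap.compLeft_apply, Function.comp_apply, AlgHom.toLinearMap_apply, map_mul,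
        AlgHom.commutes, augmentation_trivialIdempotent hm, mul_one]
      rfl

end EvenLength

/-! ### Quasi-cyclic codes over `F` as codes over `F[Y] / (Y ^ m - 1)` -/

theorem val_finRotate_iterate {N : ℕ} (t : ℕ) (k : Fin N) :
    (((finRotate N)^[t] k : Fin N) : ℕ) = (k + t) % N := by
  obtain _ | N := N
  · exact k.elim0
  · induction t with
    | zero => simp [Nat.mod_eq_of_lt k.2]
    | succ t ih =>
      rw [Function.iterate_succ_apply', finRotate_apply, Fin.val_add, ih, Fin.val_one',
        Nat.add_mod_mod, Nat.mod_add_mod, add_assoc]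

theorem shift_iterate_apply {F : Type*} {N : ℕ} (t : ℕ) (c : Fin N → F) (k : Fin N) :
    shift^[t] c ((finRotate N)^[t] k) = c k := by
  induction t generalizing k with
  | zero => rfl
  | succ t ih =>
    rw [Function.iterate_succ_apply', Function.iterate_succ_apply', shift,
      Equiv.symm_apply_apply, ih]

theorem finRotate_iterate_finProdFinEquiv {m n : ℕ} (i : Fin m) (j : Fin n) :
    (finRotate (m * n))^[n] (finProdFinEquiv (i, j)) = finProdFinEquiv (finRotate m i, j) := by
  have hn : 0 < n := j.pos
  have hi := val_finRotate_iterate 1 i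
  rw [Function.iterate_one] at hi
  ext
  rw [val_finRotate_iterate, finProdFinEquiv_apply_val, finProdFinEquiv_apply_val, hi, mul_comm m n,
    Nat.mod_mul]
  have h : (j : ℕ) + n * i + n = j + n * (i + 1) := by ring
  simp only [h, Nat.add_mul_mod_self_left, Nat.mod_eq_of_lt j.2, Nat.add_mul_div_left _ _ hn,
    Nat.div_eq_of_lt j.2, zero_add]

theorem Y_pow_mod {F : Type*} [Field F] {m : ℕ} (k : ℕ) : Y F m ^ (k % m) = Y F m ^ k := by
  conv_rhs => rw [← Nat.mod_add_div k m, pow_add, pow_mul, Y_pow, one_pow, mul_one]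

/-- Under `phi`, the `n`-fold cyclic shift is the multiplication by `Y`. -/
theorem phi_shift_iterate {F : Type*} [Field F] {m n : ℕ} (c : Fin (m * n) → F) :
    phi F m n (shift^[n] c) = Y F m • phi F m n c := by
  funext j
  change ∑ i : Fin m, shift^[n] c (finProdFinEquiv (i, j)) • Y F m ^ (i : ℕ)
    = Y F m * ∑ i : Fin m, c (finProdFinEquiv (i, j)) • Y F m ^ (i : ℕ)
  rw [← Equiv.sum_comp (finRotate m), Finset.mul_sum]
  refine Finset.sum_congr rfl fun i _ => ?_
  have hi := val_finRotate_iterate 1 i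
  rw [Function.iterate_one] at hi
  rw [← finRotate_iterate_finProdFinEquiv, shift_iterate_apply, hi, Y_pow_mod, pow_succ',
    mul_smul_comm]

section PowBasis

variable {F : Type*} [Field F] {m : ℕ} [NeZero m]

/-- The `F`-basis `1, Y, …, Y ^ (m - 1)` of `R`. -/
noncomputable def powBasis (F : Type*) [Field F] (m : ℕ) [NeZero m] :
    Module.Basis (Fin m) F (QCRing F m) :=
  (AdjoinRoot.powerBasis' (g := (X ^ m - 1 : F[X]))
    (by simpa using monic_X_pow_sub_C (1 : F) (NeZero.ne m))).basis.reindex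
    (finCongr (by simpa using natDegree_X_pow_sub_C (n := m) (r := (1 : F))))

theorem powBasis_apply (i : Fin m) : powBasis F m i = Y F m ^ (i : ℕ) := by
  simp [powBasis, Y]

/-- The coefficient of `Y ^ 0`, an `F`-linear functional on `R`. -/
noncomputable def constCoeff (F : Type*) [Field F] (m : ℕ) [NeZero m] : QCRing F m →ₗ[F] F :=
  (powBasis F m).coord 0

theorem constCoeff_Y_pow (k : ℕ) : constCoeff F m (Y F m ^ k) = if m ∣ k then 1 else 0 := by
  have h : Y F m ^ k = powBasis F m ⟨k % m, Nat.mod_lt _ (NeZero.pos m)⟩ := by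
    rw [powBasis_apply, Y_pow_mod]
  rw [constCoeff, Module.Basis.coord_apply, h, Module.Basis.repr_self, Finsupp.single_apply]
  simp [Fin.ext_iff, Nat.dvd_iff_mod_eq_zero]

theorem constCoeff_powBasis_mul_conj (i j : Fin m) :
    constCoeff F m (powBasis F m i * conj F m (powBasis F m j)) = if i = j then 1 else 0 := by
  rw [powBasis_apply, powBasis_apply, map_pow, conj_Y, ← pow_mul, ← pow_add, constCoeff_Y_pow]
  refine if_congr ?_ rfl rfl
  have hm : ((m - 1 : ℕ) : ℤ) = m - 1 := by
    have := NeZero.pos m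
    omega
  rw [← Int.natCast_dvd_natCast, Fin.ext_iff]
  push_cast [hm]
  have h : (i : ℤ) + (m - 1) * j = (i - j) + m * j := by ring
  rw [h, dvd_add_left (dvd_mul_right _ _)]
  constructor
  · intro hd
    have hz := Int.eq_zero_of_abs_lt_dvd hd (by rw [abs_lt]; omega)
    omega
  · intro he
    simp [he]

/-- The functional `constCoeff` turns the Hermitian form of `R` into the Euclidean one. -/
theorem constCoeff_mul_conj (a b : QCRing F m) :
    constCoeff F m (a * conj F m b) =
      ∑ i, (powBasis F m).repr a i * (powBasis F m).repr b i := by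
  conv_lhs => rw [← (powBasis F m).sum_repr a, ← (powBasis F m).sum_repr b]
  rw [map_sum, Finset.sum_mul_sum, map_sum]
  refine Finset.sum_congr rfl fun i _ => ?_
  rw [map_sum, Finset.sum_eq_single i]
  · rw [map_smul, smul_mul_smul_comm, map_smul, constCoeff_powBasis_mul_conj, if_pos rfl,
      smul_eq_mul, mul_one]
  · intro j _ hj
    rw [map_smul, smul_mul_smul_comm, map_smul, constCoeff_powBasis_mul_conj, if_neg hj.symm,
      smul_zero]
  · simp

theorem eq_zero_of_constCoeff_mul_eq_zero {a : QCRing F m}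
    (h : ∀ r, constCoeff F m (r * a) = 0) : a = 0 := by
  refine (powBasis F m).repr.map_eq_zero_iff.1 (Finsupp.ext fun i => ?_)
  have hi := h (conj F m (powBasis F m i))
  rw [mul_comm, constCoeff_mul_conj, Module.Basis.repr_self] at hi
  simpa [Finsupp.single_apply] using hi

end PowBasis

section Phi

variable {F : Type*} [Field F] {m n : ℕ} [NeZero m]

theorem repr_phi (c : Fin (m * n) → F) (j : Fin n) (i : Fin m) :
    (powBasis F m).repr (phi F m n c j) i = c (finProdFinEquiv (i, j)) := by
  have h : phi F m n c j = ∑ i, c (finProdFinEquiv (i, j)) • powBasis F m i := by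
    simp only [powBasis_apply]
    rfl
  rw [h, Module.Basis.repr_sum_self]

theorem phi_injective : Function.Injective (phi F m n) := by
  intro a b h
  ext k
  obtain ⟨⟨i, j⟩, rfl⟩ := finProdFinEquiv.surjective k
  rw [← repr_phi a, h, repr_phi]

theorem phi_surjective : Function.Surjective (phi F m n) := by
  intro x
  refine ⟨fun k => (powBasis F m).repr (x (finProdFinEquiv.symm k).2) (finProdFinEquiv.symm k).1,
    funext fun j => (powBasis F m).repr.injective (Finsupp.ext fun i => ?_)⟩
  rw [repr_phi, Equiv.symm_apply_apply]

theorem constCoeff_hermInner_phi (a b : Fin (m * n) → F) :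
    constCoeff F m (hermInner (phi F m n a) (phi F m n b)) = ∑ k, a k * b k := by
  rw [hermInner, map_sum, ← finProdFinEquiv.sum_comp, Fintype.sum_prod_type_right]
  refine Finset.sum_congr rfl fun j _ => ?_
  rw [constCoeff_mul_conj]
  simp only [repr_phi]

/-- The image under `phi` of an `n`-quasi-cyclic code over `F`, as a code over `R`. -/
noncomputable def IsQuasiCyclic.code {D : Submodule F (Fin (m * n) → F)}
    (hD : IsQuasiCyclic n D) : Submodule (QCRing F m) (Fin n → QCRing F m) where
  carrier := phi F m n '' D
  zero_mem' := ⟨0, D.zero_mem, map_zero _⟩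
  add_mem' := by
    rintro _ _ ⟨a, ha, rfl⟩ ⟨b, hb, rfl⟩
    exact ⟨a + b, D.add_mem ha hb, map_add _ _ _⟩
  smul_mem' := by
    rintro r _ ⟨a, ha, rfl⟩
    have hpow : ∀ k : ℕ, ∃ b ∈ D, phi F m n b = Y F m ^ k • phi F m n a := by
      intro k
      induction k with
      | zero => exact ⟨a, ha, by simp⟩
      | succ k ih =>
        obtain ⟨b, hb, h⟩ := ih
        exact ⟨_, hD b hb, by rw [phi_shift_iterate, h, smul_smul, pow_succ']⟩
    have hr := (powBasis F m).sum_repr r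
    choose b hb h using hpow
    refine ⟨∑ i, (powBasis F m).repr r i • b i, D.sum_mem fun i _ => D.smul_mem _ (hb _), ?_⟩
    conv_rhs => rw [← hr, Finset.sum_smul]
    rw [map_sum]
    refine Finset.sum_congr rfl fun i _ => ?_
    rw [map_smul, h, powBasis_apply, smul_assoc]

theorem IsQuasiCyclic.phiInv_code {D : Submodule F (Fin (m * n) → F)} (hD : IsQuasiCyclic n D) :
    phiInv hD.code = D := by
  ext x
  constructor
  · rintro ⟨a, ha, h⟩
    exact phi_injective h ▸ ha
  · exact fun hx => ⟨x, hx, rfl⟩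

theorem IsQuasiCyclic.isHermSelfDual_code {D : Submodule F (Fin (m * n) → F)}
    (hD : IsQuasiCyclic n D) (hsd : IsEuclideanSelfDual D) : IsHermSelfDual hD.code := by
  ext x
  constructor
  · intro hx _ ⟨b, hb, hy⟩
    -- Not only `x`, but every multiple `r x` is orthogonal to the code under the Euclidean form.
    refine eq_zero_of_constCoeff_mul_eq_zero fun r => ?_
    obtain ⟨a, ha, h⟩ := hD.code.smul_mem r hx
    rw [← hermInner_smul_left, ← h, ← hy, constCoeff_hermInner_phi]
    exact hsd.mem_iff.1 ha b hb
  · intro hx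
    obtain ⟨a, rfl⟩ := phi_surjective x
    refine ⟨a, hsd.mem_iff.2 fun b hb => ?_, rfl⟩
    rw [← constCoeff_hermInner_phi, hx _ ⟨b, hb, rfl⟩, map_zero]

end Phi

end QuasiCyclic

theorem mainTheorem1 {F : Type*} [Field F] [Fintype F] (p : ℕ) (hp : p.Prime)
    (hF : CharP F 2 ∨ Fintype.card F ≡ 1 [MOD 4])
    (hq : QuasiCyclic.IsPrimitiveElementMod (Fintype.card F) p) :
    (∀ ℓ : ℕ, 1 ≤ ℓ →
      ∀ C : Submodule (QuasiCyclic.QCRing F p) (Fin (2 * ℓ + 2) → QuasiCyclic.QCRing F p),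
        QuasiCyclic.IsHermSelfDual C →
        ∃ C' : Submodule (QuasiCyclic.QCRing F p) (Fin (2 * ℓ + 2) → QuasiCyclic.QCRing F p),
          QuasiCyclic.IsBuiltUp C' ∧ QuasiCyclic.PermEquivalent C' C) ∧
    (∀ n : ℕ, 2 < n →
      ∀ D : Submodule F (Fin (p * n) → F),
        QuasiCyclic.IsQuasiCyclic n D → QuasiCyclic.IsEuclideanSelfDual D →
        ∃ (ℓ : ℕ)
          (E' : Submodule (QuasiCyclic.QCRing F p) (Fin (2 * ℓ + 2) → QuasiCyclic.QCRing F p))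
          (E : Submodule (QuasiCyclic.QCRing F p) (Fin n → QuasiCyclic.QCRing F p)),
          n = 2 * ℓ + 2 ∧ QuasiCyclic.IsBuiltUp E' ∧ QuasiCyclic.PermEquivalent E' E ∧
            D = QuasiCyclic.phiInv E) := by
  refine ⟨fun ℓ hℓ C hC => hC.exists_permEquivalent_isBuiltUp hp hF hq hℓ,
    fun n hn D hD hsd => ?_⟩
  have : NeZero p := ⟨hp.ne_zero⟩
  have hE := hD.isHermSelfDual_code hsd
  obtain ⟨k, hk⟩ :=
    (hE.isEuclideanSelfDual_augmentationCode (hq.natCast_ne_zero hp)).even_length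
  obtain ⟨ℓ, rfl⟩ : ∃ ℓ, n = 2 * ℓ + 2 := ⟨k - 1, by omega⟩
  obtain ⟨E', hE', hperm⟩ := hE.exists_permEquivalent_isBuiltUp hp hF hq (ℓ := ℓ) (by omega)
  exact ⟨ℓ, E', hD.code, rfl, hE', hperm, hD.phiInv_code.symm⟩
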